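/- Let $p\in\mathbb R^3$, let $v_1,v_2,v_3\in S^2\subset\mathbb R^3$ be linearly independent unit vectors, and let $$A=\{\,p+c_1v_1+c_2v_2+c_3v_3 : c_1,c_2,c_3\ge 0\,\}$$ be the trihedral solid angle with apex $p$ whose corresponding spherical triangle is $v_1v_2v_3$. Let $t_1,t_2,t_3\in S^2$ be the vertices of a regular spherical triangle with side length $\pi/3$. Spherical segments and triangles are understood to be closed (a triangle contains its sides). Then the following are equivalent. (i) There is a (nondegenerate) regular octahedron inscribed into the boundary of $A$, that is, all six of its vertices lie on $\partial A$. (ii) The triangle $v_1v_2v_3$ can be placed inside the triangle $t_1t_2t_3$ in the following way: there are a linear isometry $g$ of $\mathbb R^3$ (orientation-preserving or not) and a permutation $\sigma$ of $\{1,2,3\}$ such that the points $w_i=g(v_{\sigma(i)})$ satisfy: the triangle $w_1w_2w_3$ is contained in the triangle $t_1t_2t_3$; $w_1=t_1$; $w_2$ lies on the spherical segment $t_1t_2$; and $w_3$ lies in the spherical triangle $t_1w_2t_3$. -/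

import Mathlib

/-- Euclidean three-space. -/
abbrev E3 : Type := EuclideanSpace ℝ (Fin 3)

/-- The unit sphere of Euclidean three-space. -/
def unitSphere : Set E3 := Metric.sphere (0 : E3) 1

/-- The great-circle segment joining the (non-antipodal) unit vectors `x` and `y`, with end points. -/
def sphericalSegment (x y : E3) : Set E3 :=
  {u | u ∈ unitSphere ∧ ∃ a b : ℝ, 0 ≤ a ∧ 0 ≤ b ∧ u = a • x + b • y}

/-- The closed spherical triangle (with its interior) with vertices `x`, `y`, `z`. -/
def sphericalTriangle (x y z : E3) : Set E3 :=
  {u | u ∈ unitSphere ∧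
    ∃ a b c : ℝ, 0 ≤ a ∧ 0 ≤ b ∧ 0 ≤ c ∧ u = a • x + b • y + c • z}

/-- The solid angle with apex `p` whose three edges are the rays from `p` in the directions `v i`. -/
def trihedralAngle (p : E3) (v : Fin 3 → E3) : Set E3 :=
  {x | ∃ c : Fin 3 → ℝ, (∀ i, 0 ≤ c i) ∧ x = p + ∑ i, c i • v i}

/-- The unit directions that lead from the apex into a trihedral solid angle form the spherical
triangle whose vertices are the directions of its edges. -/
theorem trihedralAngle_section (p : E3) (v : Fin 3 → E3) :
    {u | u ∈ unitSphere ∧ p + u ∈ trihedralAngle p v} =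
      sphericalTriangle (v 0) (v 1) (v 2) := by
  ext u
  constructor
  · rintro ⟨hu, c, hc, h⟩
    refine ⟨hu, c 0, c 1, c 2, hc 0, hc 1, hc 2, ?_⟩
    simpa [Fin.sum_univ_three] using h
  · rintro ⟨hu, a, b, c, ha, hb, hc, h⟩
    refine ⟨hu, ![a, b, c], ?_, ?_⟩
    · intro i
      fin_cases i <;> simpa
    · simp [Fin.sum_univ_three, h]

/-- The six vertices of the regular octahedron with centre `o`, circumradius `r`, and axes in the
directions of the orthonormal vectors `u i`. -/
def octahedronVertices (o : E3) (r : ℝ) (u : Fin 3 → E3) : Set E3 :=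
  {x | ∃ i, x = o + r • u i ∨ x = o - r • u i}

/-- Some nondegenerate regular octahedron has all its vertices on the boundary of `K`. -/
def AdmitsInscribedRegularOctahedron (K : Set E3) : Prop :=
  ∃ (o : E3) (r : ℝ) (u : Fin 3 → E3),
    0 < r ∧ Orthonormal ℝ u ∧ octahedronVertices o r u ⊆ frontier K

/-- `t` is the vertex triple of a regular spherical triangle with side length `s` (for unit vectors
the spherical distance is the angle between them). -/
def IsRegularSphericalTriangle (t : Fin 3 → E3) (s : ℝ) : Prop :=
  (∀ i, t i ∈ unitSphere) ∧ ∀ i j, i ≠ j → InnerProductGeometry.angle (t i) (t j) = s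

/-- The spherical triangle `w 0, w 1, w 2` lies in the spherical triangle `t 0, t 1, t 2` so that
`w 0 = t 0`, `w 1` is on the segment from `t 0` to `t 1`, and `w 2` lies in the triangle
`t 0, w 1, t 2`. -/
def ProperlyPlaced (w t : Fin 3 → E3) : Prop :=
  sphericalTriangle (w 0) (w 1) (w 2) ⊆ sphericalTriangle (t 0) (t 1) (t 2) ∧
    w 0 = t 0 ∧ w 1 ∈ sphericalSegment (t 0) (t 1) ∧
    w 2 ∈ sphericalTriangle (t 0) (w 1) (t 2)

/-! If (ii) holds, the octahedron is explicit. The vectors `t 0`, `t 1`, `t 2` are edge directions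
of the octahedron with axes `cubeAxes t`, and proper placement says that `v 1` and `v 2` are
successive nonnegative combinations. Place the octahedron with a face in the plane of `v 0`, `v 1`,
an edge parallel to `v 0` in the plane of `v 0`, `v 2`, and a vertex in the third plane; the signs
of the coefficients keep all six vertices in the angle
(`admitsInscribedRegularOctahedron_of_regular`).

Conversely, scale the inner face normals `n i` so that the three face planes support the octahedron
at height 1. The matrix of inner products of `n i` with the axes `u j` then has entries in [-1, 1],
and every column contains both 1 and -1, leaving one free entry per column. Up to permutations and
signs two patterns survive. If two columns have their free entry in the same row, the edges of the
given octahedron already provide the regular triangle (`placeable_of_repeated`). If the free entries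
lie in distinct rows, they can be moved to the diagonal as x, y, z, with determinant d = xyz + x + y
+ z. Then d can be made positive and y minimal, and placement amounts to three inequalities: side `v
0 v 1` is at most π/3, the dihedral angle along `v 0` is at most that of a regular tetrahedron, and
`v 2` is on the correct side of the plane through `v 1` and the third vertex of the regular triangle
(`placeable_of_cyclic_of_le`). -/

/-! ### Polynomial and radical inequalities for the cyclic pattern. -/

/-- The polynomials below are affine in x, so this reduces them to the ends of the range of x. -/
theorem affine_nonneg {p q l h x : ℝ} (hl : l ≤ x) (hh : x ≤ h) (h1 : 0 ≤ p * l + q)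
    (h2 : 0 ≤ p * h + q) : 0 ≤ p * x + q := by
  rcases le_total 0 p with hp | hp
  · nlinarith [mul_le_mul_of_nonneg_left hl hp]
  · nlinarith [mul_le_mul_of_nonpos_left hh hp]

theorem octahedron_edge_ineq {x y z : ℝ} (hyx : y ≤ x) (hx : x ≤ 1) (hy : -1 ≤ y)
    (hz : -1 ≤ z) (hz1 : z ≤ 1) :
    (x * y * z + x + y + z) * (5 + z ^ 2) ≤
      6 * ((1 + y * z) * (1 + z) + (1 - z) * (1 + z * x) + (1 + y) * (1 - x)) := by
  have hy1 : y ≤ 1 := hyx.trans hx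
  have e1 : 0 ≤ (1 - z) * (1 + z) := mul_nonneg (by linarith) (by linarith)
  have h := affine_nonneg (p := 6 * ((1 - z) * z - (1 + y)) - (y * z + 1) * (5 + z ^ 2))
    (q := 6 * ((1 + y * z) * (1 + z) + (1 - z) + (1 + y)) - (y + z) * (5 + z ^ 2)) hyx hx
    (by
      have : 0 ≤ (1 - y) * (1 - z) * (12 + 2 * (5 + z ^ 2)) + (1 + y) * ((1 + z) * (2 - 2 * z ^ 2))
          + (1 - y) * (1 + y) * (2 * (1 + z) * (6 - z + z ^ 2)) := by
        have a1 : 0 ≤ 1 - y := by linarith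
        have a2 : 0 ≤ 1 + y := by linarith
        have a3 : 0 ≤ 1 - z := by linarith
        have a4 : 0 ≤ 1 + z := by linarith
        have a5 : 0 ≤ 2 - 2 * z ^ 2 := by nlinarith
        have a6 : 0 ≤ 6 - z + z ^ 2 := by nlinarith
        positivity
      nlinarith [this])
    (by
      have := affine_nonneg (p := (1 + z) * (6 * z - (5 + z ^ 2)))
        (q := (1 + z) * (6 * (2 - z) - (5 + z ^ 2))) hy hy1
        (by nlinarith) (by nlinarith [mul_nonneg e1 (by linarith : 0 ≤ 1 + z)])
      nlinarith [this])
  nlinarith [h]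

theorem octahedron_side_ineq_one {y z : ℝ} (hy : -1 ≤ y) (hy1 : y ≤ 1) (hz : -1 ≤ z)
    (hz1 : z ≤ 1) :
    0 ≤ 4 * (2 - z) * (2 + y + y * z) + 2 * (1 + z) * (2 + y * z - z)
      - (5 + z ^ 2) * (1 + y) * (1 + z) := by
  have := affine_nonneg (p := 4 * (2 - z) * (1 + z) + 2 * (1 + z) * z - (5 + z ^ 2) * (1 + z))
    (q := 4 * (2 - z) * 2 + 2 * (1 + z) * (2 - z) - (5 + z ^ 2) * (1 + z)) hy hy1
    (by nlinarith)
    (by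
      have h := mul_nonneg (sub_nonneg.2 hz1) (by nlinarith : 0 ≤ 18 + 8 * z + 2 * z ^ 2)
      nlinarith [h])
  nlinarith [this]

/-- The end x = y of the side inequality; the polynomial factors as 1 - z times a quadratic in y
that is nonnegative. -/
theorem octahedron_side_ineq_diag {y z : ℝ} (hz : -1 ≤ z) (hz1 : z ≤ 1) :
    0 ≤ 4 * (1 + y - z) * (2 + y + y * z) + 2 * (3 + 2 * y * z - y ^ 2)
      - (5 + z ^ 2) * (y ^ 2 * z + 2 * y + z) := by
  have h : 0 ≤ (2 + z + z ^ 2) * y ^ 2 + (2 + 6 * z) * y + (14 + z + z ^ 2) := by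
    nlinarith [sq_nonneg (y + z), sq_nonneg (y + 2 * z), sq_nonneg (y + 1), sq_nonneg (z * y + 1),
      sq_nonneg y, sq_nonneg z, sq_nonneg (z * y),
      mul_nonneg (sq_nonneg y) (by linarith : 0 ≤ 1 + z)]
  nlinarith [mul_nonneg (by linarith : 0 ≤ 1 - z) h]

theorem octahedron_side_ineq_diag' {y z : ℝ} (hz : -1 ≤ z) (hz1 : z ≤ 1) :
    0 ≤ 4 * (1 + y - z) * (3 + y + y * z - z) + 2 * (3 + 2 * y * z - y ^ 2)
      - (5 + z ^ 2) * (y ^ 2 * z + 2 * y + z) := by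
  have h : 0 ≤ (2 + z + z ^ 2) * y ^ 2 + (6 + 6 * z) * y + (18 - 3 * z + z ^ 2) := by
    nlinarith [sq_nonneg (y + z), sq_nonneg (y + 2 * z), sq_nonneg (y + 1), sq_nonneg (z * y + 3),
      sq_nonneg (y + 3), sq_nonneg (y + 2), sq_nonneg (z * y + 2),
      sq_nonneg y, sq_nonneg z, sq_nonneg (z * y),
      mul_nonneg (sq_nonneg y) (by linarith : 0 ≤ 1 + z)]
  nlinarith [mul_nonneg (by linarith : 0 ≤ 1 - z) h]

/-- The value x = z - 1, where 1 + x - z changes sign. The expression is affine in y, and its end y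
= z - 1 is the diagonal case. -/
theorem octahedron_side_ineq_mid {y z : ℝ} (hy : -1 ≤ y) (hyz : y ≤ z - 1) (hz1 : z ≤ 1) :
    0 ≤ 2 * ((1 + y * z) * (1 + z) + (1 - z) * (1 + z * (z - 1)) + (1 + y) * (2 - z))
      - (5 + z ^ 2) * ((z - 1) * y * z + (z - 1) + y + z) := by
  have hz : 0 ≤ z := by linarith
  have h := octahedron_side_ineq_diag (y := z - 1) (by linarith) hz1
  have a := mul_nonneg (by linarith : 0 ≤ 1 - z) hz
  have := affine_nonneg (p := 2 * (z * (1 + z) + (2 - z)) - (5 + z ^ 2) * ((z - 1) * z + 1))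
    (q := 2 * ((1 + z) + (1 - z) * (1 + z * (z - 1)) + (2 - z)) - (5 + z ^ 2) * ((z - 1) + z))
    hy hyz
    (by
      have : 0 ≤ 2 * ((1 - z) * (1 + z) + (1 - z) * (1 - z + z ^ 2))
          + (5 + z ^ 2) * ((1 - z) * (1 - z) + (1 - z)) := by
        have a3 : 0 ≤ 1 - z := by linarith
        have a6 : 0 ≤ 1 - z + z ^ 2 := by nlinarith
        positivity
      nlinarith [this])
    (by nlinarith [h])
  nlinarith [this]

theorem octahedron_side_ineq_of_nonneg {x y z : ℝ} (hyx : y ≤ x) (hx : x ≤ 1) (hy : -1 ≤ y)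
    (hz : -1 ≤ z) (hz1 : z ≤ 1) (h : 0 ≤ 1 + x - z) :
    0 ≤ 4 * (1 + x - z) * (2 + y + y * z)
      + 2 * ((1 + y * z) * (1 + z) + (1 - z) * (1 + z * x) + (1 + y) * (1 - x))
      - (5 + z ^ 2) * (x * y * z + x + y + z) := by
  have h1 := octahedron_side_ineq_one hy (hyx.trans hx) hz hz1
  have key : ∀ l, l ≤ x → 0 ≤ 4 * (1 + l - z) * (2 + y + y * z)
      + 2 * ((1 + y * z) * (1 + z) + (1 - z) * (1 + z * l) + (1 + y) * (1 - l))
      - (5 + z ^ 2) * (l * y * z + l + y + z) → 0 ≤ 4 * (1 + x - z) * (2 + y + y * z)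
      + 2 * ((1 + y * z) * (1 + z) + (1 - z) * (1 + z * x) + (1 + y) * (1 - x))
      - (5 + z ^ 2) * (x * y * z + x + y + z) := by
    intro l hl h2
    have := affine_nonneg
      (p := 4 * (2 + y + y * z) + 2 * ((1 - z) * z - (1 + y)) - (5 + z ^ 2) * (y * z + 1))
      (q := 4 * (1 - z) * (2 + y + y * z) + 2 * ((1 + y * z) * (1 + z) + (1 - z) + (1 + y))
        - (5 + z ^ 2) * (y + z)) hl hx (by linarith) (by linarith)
    linarith
  rcases le_total (z - 1) y with hc | hc
  · exact key y hyx (by linarith [octahedron_side_ineq_diag (y := y) hz hz1])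
  · exact key (z - 1) (by linarith) (by linarith [octahedron_side_ineq_mid hy hc hz1])

theorem octahedron_side_ineq_of_nonpos {x y z : ℝ} (hyx : y ≤ x) (hy : -1 ≤ y)
    (hz : -1 ≤ z) (hz1 : z ≤ 1) (h : 1 + x - z ≤ 0) :
    0 ≤ 4 * (1 + x - z) * (3 + y + y * z - z)
      + 2 * ((1 + y * z) * (1 + z) + (1 - z) * (1 + z * x) + (1 + y) * (1 - x))
      - (5 + z ^ 2) * (x * y * z + x + y + z) := by
  have h1 := octahedron_side_ineq_diag' (y := y) hz hz1
  have h2 := octahedron_side_ineq_mid hy (by linarith) hz1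
  have := affine_nonneg
    (p := 4 * (3 + y + y * z - z) + 2 * ((1 - z) * z - (1 + y)) - (5 + z ^ 2) * (y * z + 1))
    (q := 4 * (1 - z) * (3 + y + y * z - z) + 2 * ((1 + y * z) * (1 + z) + (1 - z) + (1 + y))
      - (5 + z ^ 2) * (y + z)) hyx (by linarith : x ≤ z - 1) (by linarith) (by linarith)
  linarith

/-- The arithmetic-geometric mean inequality for 3 and 2 + z², sharp at z = ±1. -/
theorem sqrt_three_mul_sqrt_le (z : ℝ) : √3 * √(2 + z ^ 2) ≤ (5 + z ^ 2) / 2 := by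
  nlinarith [sq_nonneg (√3 - √(2 + z ^ 2)), Real.sq_sqrt (by norm_num : (0 : ℝ) ≤ 3),
    Real.sq_sqrt (by positivity : (0 : ℝ) ≤ 2 + z ^ 2)]

/-- The remaining root is replaced by a linear bound in the direction dictated by the sign of 1 + x
- z. With A = 1 + yz, B = 1 + y, C = 1 - z, the root is at least 2(A + B), since (A + B)² ≤ 2(A² +
B²), and at most 2(A + B + C). -/
theorem octahedron_sqrt_side_ineq {x y z : ℝ} (hyx : y ≤ x) (hx : x ≤ 1) (hy : -1 ≤ y)
    (hz : -1 ≤ z) (hz1 : z ≤ 1) (hd : 0 ≤ x * y * z + x + y + z) :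
    √3 * (x * y * z + x + y + z) * √(2 + z ^ 2) ≤
      2 * √2 * √((1 + y * z) ^ 2 + (1 - z) ^ 2 + (1 + y) ^ 2) * (1 + x - z) +
      ((1 + y * z) * (1 + z) + (1 - z) * (1 + z * x) + (1 + y) * (1 - x)) := by
  have hy1 : y ≤ 1 := hyx.trans hx
  have hb := mul_le_mul_of_nonneg_left (sqrt_three_mul_sqrt_le z) hd
  have hk : 2 * √2 * √((1 + y * z) ^ 2 + (1 - z) ^ 2 + (1 + y) ^ 2)
      = √(8 * ((1 + y * z) ^ 2 + (1 - z) ^ 2 + (1 + y) ^ 2)) := by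
    rw [Real.sqrt_mul (by norm_num), show (8 : ℝ) = 2 ^ 2 * 2 by norm_num,
      Real.sqrt_mul (by norm_num), Real.sqrt_sq (by norm_num)]
  rw [hk]
  have p1 : 0 ≤ 1 - y := by linarith
  have p2 : 0 ≤ 1 + y := by linarith
  have p3 : 0 ≤ 1 - z := by linarith
  have p4 : 0 ≤ 1 + z := by linarith
  rcases le_total 0 (1 + x - z) with h | h
  · have hl : 2 * (2 + y + y * z) ≤ √(8 * ((1 + y * z) ^ 2 + (1 - z) ^ 2 + (1 + y) ^ 2)) := by
      apply Real.le_sqrt_of_sq_le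
      nlinarith [sq_nonneg (y * (1 - z)), sq_nonneg (1 - z)]
    nlinarith [octahedron_side_ineq_of_nonneg hyx hx hy hz hz1 h, mul_le_mul_of_nonneg_right hl h]
  · have hu : √(8 * ((1 + y * z) ^ 2 + (1 - z) ^ 2 + (1 + y) ^ 2)) ≤ 2 * (3 + y + y * z - z) := by
      have q1 : 0 ≤ (1 + y) * (3 - y + z * (1 + y)) := mul_nonneg p2 (by nlinarith)
      apply Real.sqrt_le_iff.2 ⟨?_, ?_⟩
      · nlinarith [mul_nonneg p2 p4]
      · nlinarith [mul_nonneg p3 q1, mul_nonneg (mul_nonneg p1 p2) (sq_nonneg (1 - z))]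
    nlinarith [octahedron_side_ineq_of_nonpos hyx hy hz hz1 h, mul_le_mul_of_nonpos_right hu h]

theorem octahedron_sqrt_edge_ineq {x y z : ℝ} (hyx : y ≤ x) (hx : x ≤ 1) (hy : -1 ≤ y)
    (hz : -1 ≤ z) (hz1 : z ≤ 1) (hd : 0 ≤ x * y * z + x + y + z) :
    √3 * (x * y * z + x + y + z) * √(2 + z ^ 2) ≤
      3 * ((1 + y * z) * (1 + z) + (1 - z) * (1 + z * x) + (1 + y) * (1 - x)) := by
  have hb := mul_le_mul_of_nonneg_left (sqrt_three_mul_sqrt_le z) hd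
  linarith [octahedron_edge_ineq hyx hx hy hz hz1]

/-- The numbers 1 - z and 1 + y are nonnegative with sum at most 2, so their squares add up to at
most 4; with (1 + yz)² ≤ 4 the radicand is at most 8, while 1 - y + z ≥ 1. -/
theorem octahedron_sqrt_dihedral_ineq {y z : ℝ} (hyz : y ≤ z) (hy : -1 ≤ y) (hz1 : z ≤ 1) :
    √((1 + y * z) ^ 2 + (1 - z) ^ 2 + (1 + y) ^ 2) ≤ 2 * √2 * (1 - y + z) := by
  have h8 : (2 * √2) ^ 2 = (8 : ℝ) := by
    rw [mul_pow, Real.sq_sqrt (by norm_num)]; norm_num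
  apply Real.sqrt_le_iff.2 ⟨by have : 0 ≤ 1 - y + z := by linarith
                               positivity, ?_⟩
  rw [mul_pow, h8]
  have h1 : (1 + y * z) ^ 2 ≤ 4 := by
    have : -1 ≤ y * z := by
      nlinarith [mul_nonneg (by linarith : 0 ≤ 1 + y) (by linarith : 0 ≤ 1 + z),
      mul_nonneg (by linarith : 0 ≤ 1 - y) (by linarith : 0 ≤ 1 - z)]
    have : y * z ≤ 1 := by
      nlinarith [mul_nonneg (by linarith : 0 ≤ 1 + y) (by linarith : 0 ≤ 1 - z),
      mul_nonneg (by linarith : 0 ≤ 1 - y) (by linarith : 0 ≤ 1 + z)]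
    nlinarith
  nlinarith [mul_nonneg (by linarith : 0 ≤ 1 + y) (by linarith : 0 ≤ 1 - z),
      mul_nonneg (by linarith : 0 ≤ 1 + y) (by linarith : 0 ≤ 1 - y),
    mul_nonneg (by linarith : 0 ≤ 1 + z) (by linarith : 0 ≤ 1 - z), sq_nonneg (y - z)]

/-! ### Regular triangles and orthonormal frames. -/

theorem isRegularSphericalTriangle_pi_div_three_iff {t : Fin 3 → E3} :
    IsRegularSphericalTriangle t (Real.pi / 3) ↔
      (∀ i, inner ℝ (t i) (t i) = 1) ∧ ∀ i j, i ≠ j → inner ℝ (t i) (t j) = 1 / 2 := by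
  have hu : (∀ i, t i ∈ unitSphere) ↔ ∀ i, inner ℝ (t i) (t i) = 1 := by
    simp only [unitSphere, mem_sphere_zero_iff_norm, real_inner_self_eq_norm_sq]
    exact forall_congr' fun i => (pow_eq_one_iff_of_nonneg (norm_nonneg _) two_ne_zero).symm
  unfold IsRegularSphericalTriangle
  rw [hu]
  refine and_congr_right fun h => ?_
  have hn : ∀ i, ‖t i‖ = 1 := by simpa [unitSphere] using hu.2 h
  refine forall_congr' fun i => forall_congr' fun j => imp_congr_right fun _ => ?_
  constructor
  · intro ha
    have := InnerProductGeometry.cos_angle_mul_norm_mul_norm (t i) (t j)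
    rw [ha, Real.cos_pi_div_three, hn, hn] at this
    linarith
  · intro ha
    rw [InnerProductGeometry.angle, ha, hn, hn, mul_one, div_one, ← Real.cos_pi_div_three]
    exact Real.arccos_cos (by positivity) (by linarith [Real.pi_pos])

theorem orthonormal_vec_three {a b c : E3} (ha : inner ℝ a a = 1) (hb : inner ℝ b b = 1)
    (hc : inner ℝ c c = 1) (hab : inner ℝ a b = 0) (hac : inner ℝ a c = 0)
    (hbc : inner ℝ b c = 0) : Orthonormal ℝ ![a, b, c] := by
  rw [orthonormal_iff_ite]
  have hba := hab; have hca := hac; have hcb := hbc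
  rw [real_inner_comm] at hba hca hcb
  intro i j
  fin_cases i <;> fin_cases j <;> simp [*, -inner_self_eq_norm_sq_to_K]

theorem Orthonormal.inner_combination {u : Fin 3 → E3} (hu : Orthonormal ℝ u)
    (a b c a' b' c' : ℝ) :
    inner ℝ (a • u 0 + b • u 1 + c • u 2) (a' • u 0 + b' • u 1 + c' • u 2) =
      a * a' + b * b' + c * c' := by
  have h := orthonormal_iff_ite.1 hu
  simp only [inner_add_left, inner_add_right, inner_smul_left, inner_smul_right, h]
  simp [mul_comm]

/-- The orthonormal basis of space with vectors `u`. -/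
noncomputable def orthonormalFrame (u : Fin 3 → E3) (hu : Orthonormal ℝ u) :
    OrthonormalBasis (Fin 3) ℝ E3 :=
  (basisOfOrthonormalOfCardEqFinrank hu (by simp)).toOrthonormalBasis (by simpa using hu)

@[simp] theorem orthonormalFrame_apply {u : Fin 3 → E3} (hu : Orthonormal ℝ u) (i : Fin 3) :
    orthonormalFrame u hu i = u i := by
  simp [orthonormalFrame]

theorem Orthonormal.eq_combination {u : Fin 3 → E3} (hu : Orthonormal ℝ u) (x : E3) :
    x = inner ℝ (u 0) x • u 0 + inner ℝ (u 1) x • u 1 + inner ℝ (u 2) x • u 2 := by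
  have := (orthonormalFrame u hu).sum_repr' x
  simpa [Fin.sum_univ_three] using this.symm

theorem Orthonormal.inner_eq {u : Fin 3 → E3} (hu : Orthonormal ℝ u) (x y : E3) :
    inner ℝ x y = inner ℝ x (u 0) * inner ℝ (u 0) y + inner ℝ x (u 1) * inner ℝ (u 1) y +
      inner ℝ x (u 2) * inner ℝ (u 2) y := by
  have := (orthonormalFrame u hu).sum_inner_mul_inner x y
  simpa [Fin.sum_univ_three] using this.symm

/-- The axes of a cube, the diagonals of three of whose faces have the directions `t i`. -/
noncomputable def cubeAxes (t : Fin 3 → E3) : Fin 3 → E3 :=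
  ![(√2)⁻¹ • (t 0 - t 1 + t 2), (√2)⁻¹ • (t 2 - t 0 - t 1), (√2)⁻¹ • (t 0 - t 1 - t 2)]

theorem inv_sqrt_two_mul_self : (√2)⁻¹ * (√2)⁻¹ = (1 / 2 : ℝ) := by
  rw [← mul_inv, Real.mul_self_sqrt (by norm_num)]; norm_num

theorem orthonormal_cubeAxes {t : Fin 3 → E3}
    (ht : IsRegularSphericalTriangle t (Real.pi / 3)) : Orthonormal ℝ (cubeAxes t) := by
  obtain ⟨h1, h2⟩ := isRegularSphericalTriangle_pi_div_three_iff.1 ht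
  have h01 := h2 0 1 (by decide)
  have h10 := h2 1 0 (by decide)
  have h02 := h2 0 2 (by decide)
  have h20 := h2 2 0 (by decide)
  have h12 := h2 1 2 (by decide)
  have h21 := h2 2 1 (by decide)
  have key : ∀ x y : E3, inner ℝ ((√2)⁻¹ • x) ((√2)⁻¹ • y) = 1 / 2 * inner ℝ x y := by
    intro x y
    rw [inner_smul_left, inner_smul_right, ← mul_assoc]
    simp only [conj_trivial, inv_sqrt_two_mul_self]
  apply orthonormal_vec_three <;> rw [key] <;>
    simp only [inner_add_left, inner_add_right, inner_sub_left, inner_sub_right, h1, h01, h10, h02,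
      h20, h12, h21] <;> norm_num

theorem eq_cubeAxes (t : Fin 3 → E3) :
    t 0 = (√2)⁻¹ • (cubeAxes t 0 - cubeAxes t 1) ∧
      t 1 = -(√2)⁻¹ • (cubeAxes t 1 + cubeAxes t 2) ∧
      t 2 = (√2)⁻¹ • (cubeAxes t 0 - cubeAxes t 2) := by
  have h := inv_sqrt_two_mul_self
  simp only [cubeAxes, Matrix.cons_val_zero, Matrix.cons_val_one, Matrix.cons_val]
  refine ⟨?_, ?_, ?_⟩ <;> match_scalars <;> linarith

/-- Both triangles have the same coordinates in their orthonormal frames `cubeAxes`, so the isometry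
matching the frames matches the triangles. -/
theorem exists_linearIsometryEquiv_of_isRegularSphericalTriangle {t t' : Fin 3 → E3}
    (ht : IsRegularSphericalTriangle t (Real.pi / 3))
    (ht' : IsRegularSphericalTriangle t' (Real.pi / 3)) :
    ∃ g : E3 ≃ₗᵢ[ℝ] E3, ∀ i, g (t' i) = t i := by
  set B := orthonormalFrame _ (orthonormal_cubeAxes ht)
  set B' := orthonormalFrame _ (orthonormal_cubeAxes ht')
  have h : ∀ i, B'.equiv B (Equiv.refl _) (cubeAxes t' i) = cubeAxes t i := by
    intro i
    have := B'.equiv_apply_basis B (Equiv.refl _) i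
    simpa [B, B'] using this
  refine ⟨B'.equiv B (Equiv.refl _), ?_⟩
  obtain ⟨a0, a1, a2⟩ := eq_cubeAxes t
  obtain ⟨b0, b1, b2⟩ := eq_cubeAxes t'
  intro i
  fin_cases i
  · change B'.equiv B (Equiv.refl _) (t' 0) = t 0
    rw [a0, b0, map_smul, map_sub, h, h]
  · change B'.equiv B (Equiv.refl _) (t' 1) = t 1
    rw [a1, b1, map_smul, map_add, h, h]
  · change B'.equiv B (Equiv.refl _) (t' 2) = t 2
    rw [a2, b2, map_smul, map_sub, h, h]

/-! ### Criteria for placement. -/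

/-- A triangle congruent to the triangle `v` is properly placed in the triangle `t`. -/
def Placeable (v t : Fin 3 → E3) : Prop :=
  ∃ (g : E3 ≃ₗᵢ[ℝ] E3) (σ : Equiv.Perm (Fin 3)), ProperlyPlaced (fun i => g (v (σ i))) t

theorem Placeable.of_comp {v t : Fin 3 → E3} (σ : Equiv.Perm (Fin 3))
    (h : Placeable (v ∘ σ) t) : Placeable v t := by
  obtain ⟨g, τ, h⟩ := h
  exact ⟨g, τ.trans σ, h⟩

/-- Any regular triangle may replace `t`, and only nonnegativity of coefficients has to be checked:
containment follows by substitution. -/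
theorem Placeable.of_regular {v t t' : Fin 3 → E3}
    (ht : IsRegularSphericalTriangle t (Real.pi / 3))
    (ht' : IsRegularSphericalTriangle t' (Real.pi / 3)) (hv : ∀ i, v i ∈ unitSphere)
    {s a b α β γ : ℝ} (hs : 0 ≤ s) (ha : 0 ≤ a) (hb : 0 ≤ b) (hα : 0 ≤ α) (hβ : 0 ≤ β)
    (hγ : 0 ≤ γ) (h0 : v 0 = s • t' 0) (h1 : v 1 = a • t' 0 + b • t' 1)
    (h2 : v 2 = α • t' 0 + β • v 1 + γ • t' 2) : Placeable v t := by
  obtain ⟨g, hg⟩ := exists_linearIsometryEquiv_of_isRegularSphericalTriangle ht ht'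
  have hs1 : s = 1 := by
    have e1 : ‖v 0‖ = 1 := by simpa [unitSphere] using hv 0
    have e2 : ‖t' 0‖ = 1 := by simpa [unitSphere] using ht'.1 0
    rw [h0, norm_smul, e2, Real.norm_of_nonneg hs, mul_one] at e1
    exact e1
  have hgv : ∀ i, g (v i) ∈ unitSphere := fun i => by simpa [unitSphere] using hv i
  have e0 : g (v 0) = t 0 := by rw [h0, hs1, one_smul, hg]
  have e1 : g (v 1) = a • t 0 + b • t 1 := by rw [h1]; simp [hg]
  have e2 : g (v 2) = α • t 0 + β • g (v 1) + γ • t 2 := by rw [h2]; simp [hg]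
  refine ⟨g, Equiv.refl _, ?_, e0, ⟨hgv 1, a, b, ha, hb, e1⟩, hgv 2, α, β, γ, hα, hβ, hγ, e2⟩
  rintro x ⟨hx, p, q, r, hp, hq, hr, rfl⟩
  refine ⟨hx, p + q * a + r * (α + β * a), q * b + r * (β * b), r * γ, by positivity,
    by positivity, by positivity, ?_⟩
  simp only [Equiv.refl_apply, e0, e1, e2]
  module

/-- The regular triangle is built on `f`: first vertex `f 0`, second in the half-plane of `v 1`,
third above. Solving for the coefficients of `v 1` and `v 2`, `hc` bounds the side by π/3, `hB`
bounds the dihedral angle along `v 0` by the one with tangent 2√2, and `hA` is the sign of the `v 0`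
coefficient of `v 2`. -/
theorem Placeable.of_orthonormal {v t f : Fin 3 → E3}
    (ht : IsRegularSphericalTriangle t (Real.pi / 3)) (hf : Orthonormal ℝ f)
    (hv : ∀ i, v i ∈ unitSphere) {s₀ s₁ s₂ c s A B C : ℝ} (h0 : v 0 = s₀ • f 0)
    (h1 : v 1 = s₁ • (c • f 0 + s • f 1)) (h2 : v 2 = s₂ • (A • f 0 + B • f 1 + C • f 2))
    (hs₀ : 0 < s₀) (hs₁ : 0 < s₁) (hs₂ : 0 < s₂) (hs : 0 < s) (hC : 0 ≤ C) (hc : s ≤ √3 * c)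
    (hB : C ≤ 2 * √2 * B) (hA : 0 ≤ 2 * √2 * (A * s - B * c) + C * (c - √3 * s)) :
    Placeable v t := by
  have r2 : √2 * √2 = (2 : ℝ) := Real.mul_self_sqrt (by norm_num)
  have r3 : √3 * √3 = (3 : ℝ) := Real.mul_self_sqrt (by norm_num)
  have p2 : 0 < √2 := by positivity
  have p3 : 0 < √3 := by positivity
  have hreg : IsRegularSphericalTriangle ![(1 : ℝ) • f 0 + (0 : ℝ) • f 1 + (0 : ℝ) • f 2,
      (1 / 2 : ℝ) • f 0 + (√3 / 2) • f 1 + (0 : ℝ) • f 2,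
      (1 / 2 : ℝ) • f 0 + (√3 / 6) • f 1 + (√2 * √3 / 3) • f 2] (Real.pi / 3) := by
    rw [isRegularSphericalTriangle_pi_div_three_iff]
    constructor
    · intro i
      fin_cases i <;> simp only [Fin.zero_eta, Fin.mk_one, Fin.reduceFinMk, Matrix.cons_val_zero,
        Matrix.cons_val_one, Matrix.cons_val, hf.inner_combination]
      · norm_num
      · linear_combination r3 / 4
      · linear_combination r3 / 36 + √2 * √2 * r3 / 9 + r2 / 3
    · intro i j hij
      fin_cases i <;> fin_cases j <;> first | exact absurd rfl hij |
        simp only [Fin.zero_eta, Fin.mk_one, Fin.reduceFinMk, Matrix.cons_val_zero,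
        Matrix.cons_val_one, Matrix.cons_val, hf.inner_combination]
      all_goals first | linear_combination (0 : ℝ) * r3 | linear_combination r3 / 12
  have hβ : 0 ≤ B - √2 * C / 4 := by nlinarith [mul_le_mul_of_nonneg_left hB p2.le]
  have hα : 0 ≤ A * s - B * c + √2 * C / 4 * (c - √3 * s) := by
    have e : A * s - B * c + √2 * C / 4 * (c - √3 * s) =
        √2 / 4 * (2 * √2 * (A * s - B * c) + C * (c - √3 * s)) := by
      linear_combination -(A * s - B * c) / 2 * r2
    rw [e]
    positivity
  refine Placeable.of_regular (s := s₀) (a := s₁ * (c - √3 * s / 3)) (b := s₁ * (2 * √3 * s / 3))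
    (γ := s₂ * (√2 * √3 * C / 2)) (β := s₂ / s₁ * ((B - √2 * C / 4) / s))
    (α := s₂ * ((A * s - B * c + √2 * C / 4 * (c - √3 * s)) / s)) ht hreg hv hs₀.le
    (mul_nonneg hs₁.le (by nlinarith)) (by positivity) (by positivity) (by positivity)
    (by positivity) ?_ ?_ ?_
  · simp [h0]
  · rw [h1]
    simp only [Matrix.cons_val_zero, Matrix.cons_val_one]
    match_scalars
    · ring
    · linear_combination -s₁ * s * r3 / 3
    · ring
  · rw [h2, h1]
    simp only [Matrix.cons_val_zero, Matrix.cons_val]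
    match_scalars
    · field_simp
      ring
    · field_simp
      linear_combination -4 * s * √2 * C * r3
    · linear_combination -s₂ * C * (√2 * √2 * r3 / 6 + r2 / 2)

/-! ### Normals supporting an octahedron, and the two matrix patterns. -/

/-- The faces of the trihedral angle with edge directions `v` have inner normals `n`, and they
support, at the same height, the regular octahedron with axes `u`. -/
structure IsSupportingFrame (v n u : Fin 3 → E3) : Prop where
  orthonormal : Orthonormal ℝ u
  pos : ∀ i, 0 < inner ℝ (n i) (v i)
  zero : ∀ i k, i ≠ k → inner ℝ (n i) (v k) = 0
  abs_inner_le : ∀ i j, |inner ℝ (n i) (u j)| ≤ 1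

namespace IsSupportingFrame

variable {v n u t : Fin 3 → E3}

theorem comp_left (h : IsSupportingFrame v n u) (σ : Equiv.Perm (Fin 3)) :
    IsSupportingFrame (v ∘ σ) (n ∘ σ) u :=
  ⟨h.orthonormal, fun _ => h.pos _, fun _ _ hik => h.zero _ _ (σ.injective.ne hik),
    fun _ _ => h.abs_inner_le _ _⟩

theorem smul_comp (h : IsSupportingFrame v n u) (τ : Equiv.Perm (Fin 3)) {ε : Fin 3 → ℝ}
    (hε : ∀ j, |ε j| = 1) : IsSupportingFrame v n (fun j => ε j • u (τ j)) := by
  refine ⟨⟨fun j => ?_, fun i j hij => ?_⟩, h.pos, h.zero, fun i j => ?_⟩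
  · rw [norm_smul, Real.norm_eq_abs, hε, h.orthonormal.1, mul_one]
  · change inner ℝ (ε i • u (τ i)) (ε j • u (τ j)) = 0
    rw [inner_smul_left, inner_smul_right, h.orthonormal.2 (τ.injective.ne hij)]
    simp
  · rw [inner_smul_right, abs_mul, hε, one_mul]
    exact h.abs_inner_le _ _

theorem placeable_of_cyclic_of_le (h : IsSupportingFrame v n u)
    (ht : IsRegularSphericalTriangle t (Real.pi / 3)) (hv : ∀ i, v i ∈ unitSphere) {x y z : ℝ}
    (h00 : inner ℝ (n 0) (u 0) = x) (h01 : inner ℝ (n 0) (u 1) = -1)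
    (h02 : inner ℝ (n 0) (u 2) = 1) (h10 : inner ℝ (n 1) (u 0) = 1)
    (h11 : inner ℝ (n 1) (u 1) = y) (h12 : inner ℝ (n 1) (u 2) = -1)
    (h20 : inner ℝ (n 2) (u 0) = -1) (h21 : inner ℝ (n 2) (u 1) = 1)
    (h22 : inner ℝ (n 2) (u 2) = z) (hd : 0 < x * y * z + x + y + z) (hyx : y ≤ x)
    (hyz : y ≤ z) : Placeable v t := by
  obtain ⟨-, hx1⟩ := abs_le.1 (h00 ▸ h.abs_inner_le 0 0)
  obtain ⟨hy, -⟩ := abs_le.1 (h11 ▸ h.abs_inner_le 1 1)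
  obtain ⟨-, hz1⟩ := abs_le.1 (h22 ▸ h.abs_inner_le 2 2)
  have hz : -1 ≤ z := hy.trans hyz
  have hu := h.orthonormal
  set d := x * y * z + x + y + z with hd_def
  set G := (1 + y * z) ^ 2 + (1 - z) ^ 2 + (1 + y) ^ 2 with hG
  set g := (1 + y * z) * (1 + z) + (1 - z) * (1 + z * x) + (1 + y) * (1 - x) with hg
  -- G = 0 would force y = -1 and z = 1, where d vanishes.
  have hGpos : 0 < G := by
    by_contra hcon
    have e1 : 1 - z = 0 := by
      nlinarith [sq_nonneg (1 + y * z), sq_nonneg (1 - z), sq_nonneg (1 + y)]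
    have e2 : 1 + y = 0 := by
      nlinarith [sq_nonneg (1 + y * z), sq_nonneg (1 - z), sq_nonneg (1 + y)]
    have : d = 0 := by
      rw [hd_def, show z = 1 by linarith, show y = -1 by linarith]; ring
    exact hd.ne' this
  set k := √G with hk
  set l := √(2 + z ^ 2) with hl
  have hkk : k * k = G := Real.mul_self_sqrt hGpos.le
  have hll : l * l = 2 + z ^ 2 := Real.mul_self_sqrt (by positivity)
  have hkpos : 0 < k := Real.sqrt_pos.2 hGpos
  have hlpos : 0 < l := Real.sqrt_pos.2 (by positivity)
  have c1 := octahedron_sqrt_edge_ineq hyx hx1 hy hz hz1 hd.le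
  have c2 := octahedron_sqrt_dihedral_ineq hyz hy hz1
  have c3 := octahedron_sqrt_side_ineq hyx hx1 hy hz hz1 hd.le
  have eq : ∀ i k, inner ℝ (n i) (v k) = inner ℝ (n i) (u 0) * inner ℝ (u 0) (v k) +
      inner ℝ (n i) (u 1) * inner ℝ (u 1) (v k) + inner ℝ (n i) (u 2) * inner ℝ (u 2) (v k) :=
    fun i k => hu.inner_eq _ _
  have eq0 : ∀ k, inner ℝ (n 0) (v k) = x * inner ℝ (u 0) (v k) - inner ℝ (u 1) (v k) +
      inner ℝ (u 2) (v k) := fun k => by rw [eq, h00, h01, h02]; ring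
  have eq1 : ∀ k, inner ℝ (n 1) (v k) = inner ℝ (u 0) (v k) + y * inner ℝ (u 1) (v k) -
      inner ℝ (u 2) (v k) := fun k => by rw [eq, h10, h11, h12]; ring
  have eq2 : ∀ k, inner ℝ (n 2) (v k) = -inner ℝ (u 0) (v k) + inner ℝ (u 1) (v k) +
      z * inner ℝ (u 2) (v k) := fun k => by rw [eq, h20, h21, h22]; ring
  -- Cramer's rule: the three vectors are the cofactor vectors of the matrix, that is, cross
  -- products of pairs of normals.
  have sol : ∀ k, v k =
      (inner ℝ (n 0) (v k) / d) • ((1 + y * z) • u 0 + (1 - z) • u 1 + (1 + y) • u 2) +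
      (inner ℝ (n 1) (v k) / d) • ((1 + z) • u 0 + (1 + z * x) • u 1 + (1 - x) • u 2) +
      (inner ℝ (n 2) (v k) / d) • ((1 - y) • u 0 + (1 + x) • u 1 + (1 + x * y) • u 2) := by
    intro k
    conv_lhs => rw [hu.eq_combination (v k)]
    rw [eq0, eq1, eq2]
    match_scalars <;> field_simp <;> rw [hd_def] <;> ring
  have v0 := sol 0
  rw [h.zero 1 0 (by decide), h.zero 2 0 (by decide)] at v0
  have v1 := sol 1
  rw [h.zero 0 1 (by decide), h.zero 2 1 (by decide)] at v1
  have v2 := sol 2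
  rw [h.zero 0 2 (by decide), h.zero 1 2 (by decide)] at v2
  simp only [zero_div, zero_smul, zero_add, add_zero] at v0 v1 v2
  have hs0 : 0 < inner ℝ (n 0) (v 0) / d := div_pos (h.pos 0) hd
  have hs1 : 0 < inner ℝ (n 1) (v 1) / d := div_pos (h.pos 1) hd
  have hs2 : 0 < inner ℝ (n 2) (v 2) / d := div_pos (h.pos 2) hd
  generalize inner ℝ (n 0) (v 0) / d = s0 at v0 hs0
  generalize inner ℝ (n 1) (v 1) / d = s1 at v1 hs1
  generalize inner ℝ (n 2) (v 2) / d = s2 at v2 hs2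
  -- An orthonormal frame adapted to the angle: `f 0` along `v 0`, `f 2` along the normal `n 2` to
  -- the face of `v 0` and `v 1`, and `f 1` their cross product. Here k and l are the lengths of the
  -- cofactor vector of `v 0` and of `n 2`.
  set f : Fin 3 → E3 := ![
    ((1 + y * z) / k) • u 0 + ((1 - z) / k) • u 1 + ((1 + y) / k) • u 2,
    ((1 + y - z * (1 - z)) / (k * l)) • u 0 + ((z * (1 + y * z) + (1 + y)) / (k * l)) • u 1 +
      (-((1 - z) + (1 + y * z)) / (k * l)) • u 2,
    (-1 / l) • u 0 + (1 / l) • u 1 + (z / l) • u 2] with hf_def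
  have f0 : f 0 = ((1 + y * z) / k) • u 0 + ((1 - z) / k) • u 1 + ((1 + y) / k) • u 2 := rfl
  have f1 : f 1 = ((1 + y - z * (1 - z)) / (k * l)) • u 0 +
      ((z * (1 + y * z) + (1 + y)) / (k * l)) • u 1 +
      (-((1 - z) + (1 + y * z)) / (k * l)) • u 2 := rfl
  have f2 : f 2 = (-1 / l) • u 0 + (1 / l) • u 1 + (z / l) • u 2 := rfl
  have hf : Orthonormal ℝ f := by
    apply orthonormal_vec_three <;> rw [hu.inner_combination] <;> field_simp
    · rw [pow_two k, hkk, hG]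
    · rw [pow_two k, pow_two l, hkk, hll, hG]; ring
    · rw [pow_two l, hll]; ring
    · ring
    · ring
    · ring
  have hv0 : v 0 = (s0 * k) • f 0 := by
    rw [v0, f0]
    match_scalars <;> field_simp
  have hv1 : v 1 = (s1 / k) • (g • f 0 + (d * l) • f 1) := by
    rw [v1, f0, f1]
    match_scalars <;> field_simp <;> rw [hd_def, hg] <;> rw [hG] at hkk
    · linear_combination (1 + z) * hkk
    · linear_combination (1 + z * x) * hkk
    · linear_combination (1 - x) * hkk
  set g' := (1 + y * z) * (1 - y) + (1 - z) * (1 + x) + (1 + y) * (1 + x * y) with hg'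
  have hv2 : v 2 = (s2 / (k * l)) • ((g' * l) • f 0 + (d * (1 - y + z)) • f 1 + (d * k) • f 2) := by
    rw [v2, f0, f1, f2]
    match_scalars <;> field_simp <;> rw [hd_def, hg'] <;> rw [hG] at hkk
    · linear_combination ((1 - y) * l ^ 2 + (x * y * z + x + y + z)) * hkk +
        ((1 - y) * ((1 + y * z) ^ 2 + (1 - z) ^ 2 + (1 + y) ^ 2) - g' * (1 + y * z)) * hll
    · linear_combination ((1 + x) * l ^ 2 - (x * y * z + x + y + z)) * hkk +
        ((1 + x) * ((1 + y * z) ^ 2 + (1 - z) ^ 2 + (1 + y) ^ 2) - g' * (1 - z)) * hll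
    · linear_combination ((1 + x * y) * l ^ 2 - z * (x * y * z + x + y + z)) * hkk +
        ((1 + x * y) * ((1 + y * z) ^ 2 + (1 - z) ^ 2 + (1 + y) ^ 2) - g' * (1 + y)) * hll
  have r3 : √3 * √3 = (3 : ℝ) := Real.mul_self_sqrt (by norm_num)
  refine Placeable.of_orthonormal ht hf hv hv0 hv1 hv2 (by positivity) (by positivity)
    (by positivity) (by positivity) (by positivity) ?_ ?_ ?_
  · have : √3 * (d * l) ≤ √3 * (√3 * g) := by linear_combination c1 - g * r3
    exact le_of_mul_le_mul_left this (by positivity)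
  · linear_combination d * c2
  · have hid : g' * (2 + z ^ 2) - (1 - y + z) * g = (1 + x - z) * (k * k) := by
      rw [hkk, hG, hg, hg']; ring
    have := mul_nonneg (mul_nonneg hd.le hkpos.le) (sub_nonneg.2 c3)
    linear_combination this - 2 * √2 * d * hid - 2 * √2 * d * g' * hll

theorem inner_apply (h : IsSupportingFrame v n u) (i k : Fin 3) :
    inner ℝ (n i) (v k) = inner ℝ (n i) (u 0) * inner ℝ (u 0) (v k) +
      inner ℝ (n i) (u 1) * inner ℝ (u 1) (v k) + inner ℝ (n i) (u 2) * inner ℝ (u 2) (v k) :=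
  h.orthonormal.inner_eq _ _

/-- A simultaneous rotation of rows and columns preserves the pattern and d, and brings the least
diagonal entry to the middle. -/
theorem placeable_of_cyclic_of_pos (h : IsSupportingFrame v n u)
    (ht : IsRegularSphericalTriangle t (Real.pi / 3)) (hv : ∀ i, v i ∈ unitSphere)
    (hc : ∀ j, inner ℝ (n (j + 1)) (u j) = 1 ∧ inner ℝ (n (j + 2)) (u j) = -1)
    (hd : 0 < inner ℝ (n 0) (u 0) * inner ℝ (n 1) (u 1) * inner ℝ (n 2) (u 2) +
      inner ℝ (n 0) (u 0) + inner ℝ (n 1) (u 1) + inner ℝ (n 2) (u 2)) : Placeable v t := by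
  have key : ∀ c : Fin 3, inner ℝ (n (1 + c)) (u (1 + c)) ≤ inner ℝ (n c) (u c) →
      inner ℝ (n (1 + c)) (u (1 + c)) ≤ inner ℝ (n (2 + c)) (u (2 + c)) → Placeable v t := by
    intro c h1 h2
    have h' := (h.comp_left (Equiv.addRight c)).smul_comp (Equiv.addRight c)
      (ε := fun _ => 1) (by simp)
    refine .of_comp (Equiv.addRight c) (h'.placeable_of_cyclic_of_le ht (fun i => hv _)
      (x := inner ℝ (n (0 + c)) (u (0 + c))) (y := inner ℝ (n (1 + c)) (u (1 + c)))
      (z := inner ℝ (n (2 + c)) (u (2 + c))) ?_ ?_ ?_ ?_ ?_ ?_ ?_ ?_ ?_ ?_ ?_ ?_)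
    all_goals try simp only [Function.comp_apply, Equiv.coe_addRight, one_smul, zero_add]
    · have := (hc (1 + c)).2
      rwa [(by decide : ∀ c : Fin 3, 1 + c + 2 = c) c] at this
    · have := (hc (2 + c)).1
      rwa [(by decide : ∀ c : Fin 3, 2 + c + 1 = c) c] at this
    · rw [add_comm 1 c]; exact (hc c).1
    · have := (hc (2 + c)).2
      rwa [(by decide : ∀ c : Fin 3, 2 + c + 2 = 1 + c) c] at this
    · rw [add_comm 2 c]; exact (hc c).2
    · have := (hc (1 + c)).1
      rwa [(by decide : ∀ c : Fin 3, 1 + c + 1 = 2 + c) c] at this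
    · fin_cases c
      · exact hd
      · change 0 < inner ℝ (n 1) (u 1) * inner ℝ (n 2) (u 2) * inner ℝ (n 0) (u 0) +
          inner ℝ (n 1) (u 1) + inner ℝ (n 2) (u 2) + inner ℝ (n 0) (u 0)
        linarith
      · change 0 < inner ℝ (n 2) (u 2) * inner ℝ (n 0) (u 0) * inner ℝ (n 1) (u 1) +
          inner ℝ (n 2) (u 2) + inner ℝ (n 0) (u 0) + inner ℝ (n 1) (u 1)
        linarith
    · exact h1
    · exact h2
  rcases le_total (inner ℝ (n 0) (u 0)) (inner ℝ (n 1) (u 1)) with h1 | h1 <;>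
  rcases le_total (inner ℝ (n 1) (u 1)) (inner ℝ (n 2) (u 2)) with h2 | h2 <;>
  rcases le_total (inner ℝ (n 0) (u 0)) (inner ℝ (n 2) (u 2)) with h3 | h3 <;>
  first
  | exact key 0 h1 h2
  | exact key 1 h2 h3
  | exact key 2 h3 h1
  | exact key 1 h2 (h2.trans h1)
  | exact key 2 (h1.trans h2) h1

theorem placeable_of_cyclic (h : IsSupportingFrame v n u)
    (ht : IsRegularSphericalTriangle t (Real.pi / 3)) (hv : ∀ i, v i ∈ unitSphere)
    (hc : ∀ j, inner ℝ (n (j + 1)) (u j) = 1 ∧ inner ℝ (n (j + 2)) (u j) = -1) :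
    Placeable v t := by
  obtain ⟨h10, h20⟩ : inner ℝ (n 1) (u 0) = 1 ∧ inner ℝ (n 2) (u 0) = -1 := hc 0
  obtain ⟨h21, h01⟩ : inner ℝ (n 2) (u 1) = 1 ∧ inner ℝ (n 0) (u 1) = -1 := hc 1
  obtain ⟨h02, h12⟩ : inner ℝ (n 0) (u 2) = 1 ∧ inner ℝ (n 1) (u 2) = -1 := hc 2
  rcases lt_trichotomy 0 (inner ℝ (n 0) (u 0) * inner ℝ (n 1) (u 1) * inner ℝ (n 2) (u 2) +
      inner ℝ (n 0) (u 0) + inner ℝ (n 1) (u 1) + inner ℝ (n 2) (u 2)) with hd | hd | hd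
  · exact h.placeable_of_cyclic_of_pos ht hv hc hd
  · exfalso
    have e0 := h.pos 0
    have e1 := h.zero 1 0 (by decide)
    have e2 := h.zero 2 0 (by decide)
    have d0 := h.zero 0 1 (by decide)
    have d1 := h.pos 1
    have d2 := h.zero 2 1 (by decide)
    rw [h.inner_apply] at e1 e2 d0 d2
    rw [h10, h12] at e1
    rw [h20, h21] at e2 d2
    rw [h01, h02] at d0
    -- When d = 0 the cofactors give linear relations between the normals; evaluated on `v 0` and on
    -- `v 1`, they force z = 1 and z = -1.
    have f0 : inner ℝ (n 0) (v 0) * (1 - inner ℝ (n 2) (u 2)) = 0 := by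
      rw [h.inner_apply, h01, h02]
      linear_combination -inner ℝ (u 1) (v 0) * hd -
        (inner ℝ (n 0) (u 0) * inner ℝ (n 2) (u 2) + 1) * e1 - (1 + inner ℝ (n 0) (u 0)) * e2
    have f1 : inner ℝ (n 1) (v 1) * (1 + inner ℝ (n 2) (u 2)) = 0 := by
      rw [h.inner_apply, h10, h12]
      linear_combination -inner ℝ (u 0) (v 1) * hd -
        (1 + inner ℝ (n 1) (u 1) * inner ℝ (n 2) (u 2)) * d0 - (1 - inner ℝ (n 1) (u 1)) * d2
    have g0 := (mul_eq_zero.1 f0).resolve_left e0.ne'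
    have g1 := (mul_eq_zero.1 f1).resolve_left d1.ne'
    linarith
  -- Swapping two rows and the same two columns and negating every axis restores the pattern and
  -- reverses the sign of d.
  · have h' := (h.comp_left (Equiv.swap 0 1)).smul_comp (Equiv.swap 0 1)
      (ε := fun _ => -1) (by simp)
    have s0 : Equiv.swap (0 : Fin 3) 1 0 = 1 := by decide
    have s1 : Equiv.swap (0 : Fin 3) 1 1 = 0 := by decide
    have s2 : Equiv.swap (0 : Fin 3) 1 2 = 2 := by decide
    refine .of_comp (Equiv.swap 0 1) (h'.placeable_of_cyclic_of_pos ht (fun i => hv _) ?_ ?_)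
    · intro j
      simp only [Function.comp_apply, inner_smul_right]
      fin_cases j
      · change -1 * inner ℝ (n (Equiv.swap 0 1 1)) (u (Equiv.swap 0 1 0)) = 1 ∧
          -1 * inner ℝ (n (Equiv.swap 0 1 2)) (u (Equiv.swap 0 1 0)) = -1
        rw [s0, s1, s2, h01, h21]; norm_num
      · change -1 * inner ℝ (n (Equiv.swap 0 1 2)) (u (Equiv.swap 0 1 1)) = 1 ∧
          -1 * inner ℝ (n (Equiv.swap 0 1 0)) (u (Equiv.swap 0 1 1)) = -1
        rw [s0, s1, s2, h20, h10]; norm_num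
      · change -1 * inner ℝ (n (Equiv.swap 0 1 0)) (u (Equiv.swap 0 1 2)) = 1 ∧
          -1 * inner ℝ (n (Equiv.swap 0 1 1)) (u (Equiv.swap 0 1 2)) = -1
        rw [s0, s1, s2, h12, h02]; norm_num
    · simp only [Function.comp_apply, inner_smul_right, s0, s1, s2]
      linarith

theorem placeable_of_repeated_of_lt (h : IsSupportingFrame v n u)
    (ht : IsRegularSphericalTriangle t (Real.pi / 3)) (hv : ∀ i, v i ∈ unitSphere)
    (h10 : inner ℝ (n 1) (u 0) = 1) (h20 : inner ℝ (n 2) (u 0) = -1)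
    (h11 : inner ℝ (n 1) (u 1) = 1) (h21 : inner ℝ (n 2) (u 1) = -1)
    (h02 : inner ℝ (n 0) (u 2) = 1) (h22 : inner ℝ (n 2) (u 2) = -1)
    (hlt : inner ℝ (n 0) (u 0) < inner ℝ (n 0) (u 1)) (hz : inner ℝ (n 1) (u 2) < 1) :
    Placeable v t := by
  obtain ⟨hx, -⟩ := abs_le.1 (h.abs_inner_le 0 0)
  obtain ⟨-, hy⟩ := abs_le.1 (h.abs_inner_le 0 1)
  obtain ⟨hz0, -⟩ := abs_le.1 (h.abs_inner_le 1 2)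
  have hu := h.orthonormal
  have eq := h.inner_apply
  generalize h00 : inner ℝ (n 0) (u 0) = x at *
  generalize h01 : inner ℝ (n 0) (u 1) = y at *
  generalize h12 : inner ℝ (n 1) (u 2) = z at *
  have hd1 : 0 < 1 - z := by linarith
  have hd2 : 0 < y - x := by linarith
  have sol : ∀ k, v k =
      (inner ℝ (n 0) (v k) / ((1 - z) * (y - x))) • ((z - 1) • u 0 + (1 - z) • u 1) +
      (inner ℝ (n 1) (v k) / ((1 - z) * (y - x))) •
        ((y - 1) • u 0 + (1 - x) • u 1 + (x - y) • u 2) +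
      (inner ℝ (n 2) (v k) / ((1 - z) * (y - x))) •
        ((y * z - 1) • u 0 + (1 - x * z) • u 1 + (x - y) • u 2) := by
    intro k
    conv_lhs => rw [hu.eq_combination (v k)]
    rw [eq, eq, eq, h00, h01, h02, h10, h11, h12, h20, h21, h22]
    match_scalars <;> field_simp <;> ring
  have v0 := sol 0
  rw [h.zero 1 0 (by decide), h.zero 2 0 (by decide)] at v0
  have v1 := sol 1
  rw [h.zero 0 1 (by decide), h.zero 2 1 (by decide)] at v1
  have v2 := sol 2
  rw [h.zero 0 2 (by decide), h.zero 1 2 (by decide)] at v2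
  simp only [zero_div, zero_smul, zero_add, add_zero] at v0 v1 v2
  have hs0 : 0 < inner ℝ (n 0) (v 0) / ((1 - z) * (y - x)) := div_pos (h.pos 0) (by positivity)
  have hs1 : 0 < inner ℝ (n 1) (v 1) / ((1 - z) * (y - x)) := div_pos (h.pos 1) (by positivity)
  have hs2 : 0 < inner ℝ (n 2) (v 2) / ((1 - z) * (y - x)) := div_pos (h.pos 2) (by positivity)
  generalize inner ℝ (n 0) (v 0) / ((1 - z) * (y - x)) = s0 at v0 hs0
  generalize inner ℝ (n 1) (v 1) / ((1 - z) * (y - x)) = s1 at v1 hs1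
  generalize inner ℝ (n 2) (v 2) / ((1 - z) * (y - x)) = s2 at v2 hs2
  have r2 := inv_sqrt_two_mul_self
  have q2 : √2 * (√2)⁻¹ = 1 := mul_inv_cancel₀ (by positivity)
  set q := (√2)⁻¹
  -- The vertices are edge directions of the given octahedron; here the bounds on the matrix entries
  -- alone make all coefficients nonnegative.
  have hreg : IsRegularSphericalTriangle ![(-q) • u 0 + q • u 1 + (0 : ℝ) • u 2,
      (0 : ℝ) • u 0 + q • u 1 + (-q) • u 2, (-q) • u 0 + (0 : ℝ) • u 1 + (-q) • u 2]
      (Real.pi / 3) := by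
    rw [isRegularSphericalTriangle_pi_div_three_iff]
    constructor
    · intro i
      fin_cases i <;> simp only [Fin.zero_eta, Fin.mk_one, Fin.reduceFinMk, Matrix.cons_val_zero,
        Matrix.cons_val_one, Matrix.cons_val, hu.inner_combination] <;>
        linear_combination 2 * r2
    · intro i j hij
      fin_cases i <;> fin_cases j <;> first | exact absurd rfl hij |
        simp only [Fin.zero_eta, Fin.mk_one, Fin.reduceFinMk, Matrix.cons_val_zero,
        Matrix.cons_val_one, Matrix.cons_val, hu.inner_combination]
      all_goals linear_combination r2
  have p1 : 0 ≤ 1 - y := by linarith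
  have p2 : 0 ≤ 1 + z := by linarith
  have p3 : 0 ≤ 1 + x := by linarith
  refine Placeable.of_regular (s := √2 * (s0 * (1 - z))) (a := √2 * (s1 * (1 - y)))
    (b := √2 * (s1 * (y - x))) (α := √2 * (s2 * ((1 - z) * (1 + x) / 2)))
    (β := s2 / s1 * ((1 + z) / 2)) (γ := √2 * (s2 * ((1 - z) * (y - x) / 2)))
    ht hreg hv (by positivity) (by positivity) (by positivity) (by positivity) (by positivity)
    (by positivity) ?_ ?_ ?_
  · rw [v0]
    simp only [Matrix.cons_val_zero]
    match_scalars
    · linear_combination s0 * (1 - z) * q2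
    · linear_combination -s0 * (1 - z) * q2
    · ring
  · rw [v1]
    simp only [Matrix.cons_val_zero, Matrix.cons_val_one]
    match_scalars
    · linear_combination s1 * (1 - y) * q2
    · linear_combination -s1 * (1 - x) * q2
    · linear_combination s1 * (y - x) * q2
  · rw [v2, v1]
    have hs : s2 / s1 * s1 = s2 := div_mul_cancel₀ _ hs1.ne'
    simp only [Matrix.cons_val_zero, Matrix.cons_val]
    match_scalars
    · linear_combination s2 * ((1 - z) * (1 + x) / 2 + (1 - z) * (y - x) / 2) * q2 -
        (1 + z) / 2 * (y - 1) * hs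
    · linear_combination -s2 * ((1 - z) * (1 + x) / 2) * q2 - (1 + z) / 2 * (1 - x) * hs
    · linear_combination s2 * ((1 - z) * (y - x) / 2) * q2 - (1 + z) / 2 * (x - y) * hs

/-- The determinant is (1 - z)(y - x), where x, y are the free entries of the first two columns and
z that of the third. It is nonzero because the angle is nondegenerate, and exchanging the first two
axes gives y > x. -/
theorem placeable_of_repeated (h : IsSupportingFrame v n u)
    (ht : IsRegularSphericalTriangle t (Real.pi / 3)) (hv : ∀ i, v i ∈ unitSphere)
    (h10 : inner ℝ (n 1) (u 0) = 1) (h20 : inner ℝ (n 2) (u 0) = -1)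
    (h11 : inner ℝ (n 1) (u 1) = 1) (h21 : inner ℝ (n 2) (u 1) = -1)
    (h02 : inner ℝ (n 0) (u 2) = 1) (h22 : inner ℝ (n 2) (u 2) = -1) : Placeable v t := by
  have hz : inner ℝ (n 1) (u 2) < 1 := by
    refine lt_of_le_of_ne (abs_le.1 (h.abs_inner_le 1 2)).2 fun hz => ?_
    have e1 := h.pos 1
    have e2 := h.zero 2 1 (by decide)
    rw [h.inner_apply] at e1 e2
    rw [h10, h11, hz] at e1
    rw [h20, h21, h22] at e2
    linarith
  rcases lt_trichotomy (inner ℝ (n 0) (u 0)) (inner ℝ (n 0) (u 1)) with hlt | heq | hlt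
  · exact h.placeable_of_repeated_of_lt ht hv h10 h20 h11 h21 h02 h22 hlt hz
  · exfalso
    have e0 := h.pos 0
    have e1 := h.zero 1 0 (by decide)
    have e2 := h.zero 2 0 (by decide)
    rw [h.inner_apply] at e0 e1 e2
    rw [h02, heq] at e0
    rw [h10, h11] at e1
    rw [h20, h21, h22] at e2
    have : (1 - inner ℝ (n 1) (u 2)) * inner ℝ (u 2) (v 0) = 0 := by
      linear_combination -e1 - e2
    have e3 := (mul_eq_zero.1 this).resolve_left (by linarith)
    have e4 : inner ℝ (u 0) (v 0) = -inner ℝ (u 1) (v 0) := by linarith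
    rw [e3, e4] at e0
    linarith
  · have h' := h.smul_comp (Equiv.swap 0 1) (ε := fun _ => 1) (by simp)
    have s0 : Equiv.swap (0 : Fin 3) 1 0 = 1 := by decide
    have s1 : Equiv.swap (0 : Fin 3) 1 1 = 0 := by decide
    have s2 : Equiv.swap (0 : Fin 3) 1 2 = 2 := by decide
    apply h'.placeable_of_repeated_of_lt ht hv <;> simpa only [one_smul, s0, s1, s2]

theorem placeable (h : IsSupportingFrame v n u)
    (ht : IsRegularSphericalTriangle t (Real.pi / 3)) (hv : ∀ i, v i ∈ unitSphere)
    (hpos : ∀ j, ∃ i, inner ℝ (n i) (u j) = 1) (hneg : ∀ j, ∃ i, inner ℝ (n i) (u j) = -1) :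
    Placeable v t := by
  -- The row of the free entry in column j is `r`; after a choice of sign, the entries 1 and -1
  -- follow it in cyclic order.
  have hr : ∀ j, ∃ (r : Fin 3) (ε : ℝ), |ε| = 1 ∧ inner ℝ (n (r + 1)) (ε • u j) = 1 ∧
      inner ℝ (n (r + 2)) (ε • u j) = -1 := by
    intro j
    obtain ⟨i, hi⟩ := hpos j
    obtain ⟨i', hi'⟩ := hneg j
    have hne : i ≠ i' := by
      rintro rfl
      linarith
    have hcase : (∃ r, r + 1 = i ∧ r + 2 = i') ∨ ∃ r, r + 1 = i' ∧ r + 2 = i := by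
      have : ∀ i i' : Fin 3, i ≠ i' →
          (∃ r, r + 1 = i ∧ r + 2 = i') ∨ ∃ r, r + 1 = i' ∧ r + 2 = i := by decide
      exact this i i' hne
    rcases hcase with ⟨r, rfl, rfl⟩ | ⟨r, rfl, rfl⟩
    · exact ⟨r, 1, by simp, by simpa using hi, by simpa using hi'⟩
    · exact ⟨r, -1, by simp, by simp [hi'], by simp [hi]⟩
  choose r ε hε h1 h2 using hr
  have h' := h.smul_comp (Equiv.refl _) hε
  simp only [Equiv.refl_apply] at h'
  generalize hw : (fun j => ε j • u j) = w at h'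
  replace h1 : ∀ j, inner ℝ (n (r j + 1)) (w j) = 1 := hw ▸ h1
  replace h2 : ∀ j, inner ℝ (n (r j + 2)) (w j) = -1 := hw ▸ h2
  by_cases hinj : Function.Injective r
  · set τ := (Equiv.ofBijective r (Finite.injective_iff_bijective.1 hinj)).symm
    have hτ : ∀ j, r (τ j) = j := Equiv.ofBijective_apply_symm_apply r _
    refine (h'.smul_comp τ (ε := fun _ => 1) (by simp)).placeable_of_cyclic ht hv fun j => ?_
    have a1 := h1 (τ j)
    have a2 := h2 (τ j)
    rw [hτ] at a1 a2
    simp only [one_smul]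
    exact ⟨a1, a2⟩
  · obtain ⟨a, b, hab, hne⟩ : ∃ a b, r a = r b ∧ a ≠ b := by
      simpa [Function.Injective] using hinj
    obtain ⟨τ, rfl, rfl⟩ : ∃ τ : Equiv.Perm (Fin 3), τ 0 = a ∧ τ 1 = b := by
      have : ∀ a b : Fin 3, a ≠ b → ∃ τ : Equiv.Perm (Fin 3), τ 0 = a ∧ τ 1 = b := by decide
      exact this a b hne
    have a0 := h1 (τ 0)
    have b0 := h2 (τ 0)
    have a1 := h1 (τ 1)
    have b1 := h2 (τ 1)
    have a2 := h1 (τ 2)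
    have b2 := h2 (τ 2)
    rw [← hab] at a1 b1
    have hcase : ∀ i j : Fin 3, i = j ∨ i = j + 1 ∨ i = j + 2 := by decide
    generalize r (τ 0) = ρ at *
    rcases hcase (r (τ 2)) ρ with hc | hc | hc <;> rw [hc] at a2 b2
    -- Three free entries in one row would make the other two normals opposite.
    · exfalso
      have h'' := h'.smul_comp τ (ε := fun _ => 1) (by simp)
      have e1 := h''.pos (ρ + 1)
      have e2 := h''.zero (ρ + 2) (ρ + 1) ((by decide : ∀ ρ : Fin 3, ρ + 2 ≠ ρ + 1) ρ)
      rw [h''.inner_apply] at e1 e2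
      simp only [one_smul, a0, a1, a2] at e1
      simp only [one_smul, b0, b1, b2] at e2
      linarith
    · refine .of_comp (Equiv.addLeft ρ) (((h'.comp_left (Equiv.addLeft ρ)).smul_comp τ
        (ε := ![1, 1, -1]) ?_).placeable_of_repeated ht (fun i => hv _) ?_ ?_ ?_ ?_ ?_ ?_)
      · intro j
        fin_cases j <;> simp
      · simpa using a0
      · simpa using b0
      · simpa using a1
      · simpa using b1
      · rw [(by decide : ∀ ρ : Fin 3, ρ + 1 + 2 = ρ) ρ] at b2
        simp [b2]
      · rw [(by decide : ∀ ρ : Fin 3, ρ + 1 + 1 = ρ + 2) ρ] at a2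
        simp [a2]
    -- The reflection i ↦ ρ - i exchanges the two rows other than ρ; negating the first two axes
    -- compensates.
    · refine .of_comp (Equiv.subLeft ρ) (((h'.comp_left (Equiv.subLeft ρ)).smul_comp τ
        (ε := ![-1, -1, 1]) ?_).placeable_of_repeated ht (fun i => hv _) ?_ ?_ ?_ ?_ ?_ ?_)
      · intro j
        fin_cases j <;> simp
      all_goals
        have f1 : ρ - 1 = ρ + 2 := (by decide : ∀ ρ : Fin 3, ρ - 1 = ρ + 2) ρ
        have f2 : ρ - 2 = ρ + 1 := (by decide : ∀ ρ : Fin 3, ρ - 2 = ρ + 1) ρ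
        rw [(by decide : ∀ ρ : Fin 3, ρ + 2 + 1 = ρ) ρ] at a2
        rw [(by decide : ∀ ρ : Fin 3, ρ + 2 + 2 = ρ + 1) ρ] at b2
        simp [f1, f2, a0, b0, a1, b1, a2, b2]

end IsSupportingFrame

/-! ### The solid angle and its boundary in coordinates. -/

/-- The basis of space formed by three linearly independent vectors. -/
noncomputable def basisOfIndependent (v : Fin 3 → E3) (hv : LinearIndependent ℝ v) :
    Module.Basis (Fin 3) ℝ E3 :=
  basisOfLinearIndependentOfCardEqFinrank hv (by simp)

@[simp] theorem basisOfIndependent_apply {v : Fin 3 → E3} (hv : LinearIndependent ℝ v)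
    (i : Fin 3) : basisOfIndependent v hv i = v i := by
  simp [basisOfIndependent]

theorem coord_basisOfIndependent {v : Fin 3 → E3} (hv : LinearIndependent ℝ v) (i j : Fin 3) :
    (basisOfIndependent v hv).coord i (v j) = if j = i then 1 else 0 := by
  rw [← basisOfIndependent_apply hv j, Module.Basis.coord_apply, Module.Basis.repr_self,
    Finsupp.single_apply]

theorem mem_trihedralAngle_iff {p x : E3} {v : Fin 3 → E3} (hv : LinearIndependent ℝ v) :
    x ∈ trihedralAngle p v ↔ ∀ i, 0 ≤ (basisOfIndependent v hv).coord i (x - p) := by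
  constructor
  · rintro ⟨c, hc, rfl⟩ i
    simpa [-Module.Basis.coord_apply, map_sum, coord_basisOfIndependent] using hc i
  · intro h
    refine ⟨_, h, ?_⟩
    have := (basisOfIndependent v hv).sum_repr (x - p)
    simp only [basisOfIndependent_apply] at this
    simp only [Module.Basis.coord_apply, this, add_sub_cancel]

theorem mem_frontier_trihedralAngle_iff {p x : E3} {v : Fin 3 → E3}
    (hv : LinearIndependent ℝ v) :
    x ∈ frontier (trihedralAngle p v) ↔
      (∀ i, 0 ≤ (basisOfIndependent v hv).coord i (x - p)) ∧
        ∃ i, (basisOfIndependent v hv).coord i (x - p) = 0 := by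
  -- Coordinates along the edges carry the angle to the closed orthant, whose interior is a product
  -- of open half-lines.
  set f : E3 ≃ₜ (Fin 3 → ℝ) := (Homeomorph.subRight p).trans
    (basisOfIndependent v hv).equivFun.toContinuousLinearEquiv.toHomeomorph with hf
  have hfx : ∀ x i, f x i = (basisOfIndependent v hv).coord i (x - p) := fun x i => rfl
  have hs : trihedralAngle p v = f ⁻¹' (Set.univ.pi fun _ => Set.Ici 0) := by
    ext x
    simp only [mem_trihedralAngle_iff hv, Set.mem_preimage, Set.mem_univ_pi, Set.mem_Ici, hfx]
  rw [hs, ← f.preimage_frontier, (isClosed_set_pi fun _ _ => isClosed_Ici).frontier_eq,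
    interior_pi_set Set.finite_univ]
  simp only [interior_Ici, Set.mem_preimage, Set.mem_sdiff, Set.mem_univ_pi, Set.mem_Ici,
    Set.mem_Ioi, hfx, not_forall, not_lt]
  refine and_congr_right fun h => exists_congr fun i =>
    ⟨fun hi => le_antisymm hi (h i), fun hi => hi.le⟩

theorem mem_frontier_trihedralAngle {p : E3} {v : Fin 3 → E3} (hv : LinearIndependent ℝ v)
    (c : Fin 3 → ℝ) (hc : ∀ i, 0 ≤ c i) (i : Fin 3) (hi : c i = 0) :
    p + ∑ i, c i • v i ∈ frontier (trihedralAngle p v) := by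
  have h : ∀ i, (basisOfIndependent v hv).coord i (p + ∑ i, c i • v i - p) = c i := by
    intro i
    simp [-Module.Basis.coord_apply, map_sum, coord_basisOfIndependent]
  rw [mem_frontier_trihedralAngle_iff hv]
  exact ⟨fun i => (h i).symm ▸ hc i, i, (h i).trans hi⟩

theorem trihedralAngle_comp_perm (p : E3) (v : Fin 3 → E3) (σ : Equiv.Perm (Fin 3)) :
    trihedralAngle p (v ∘ σ) = trihedralAngle p v := by
  ext x
  constructor
  · rintro ⟨c, hc, rfl⟩
    refine ⟨c ∘ σ.symm, fun i => hc _, ?_⟩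
    rw [← Equiv.sum_comp σ fun i => (c ∘ σ.symm) i • v i]
    simp
  · rintro ⟨c, hc, rfl⟩
    refine ⟨c ∘ σ, fun i => hc _, ?_⟩
    rw [← Equiv.sum_comp σ]
    simp

/-! ### The two implications. -/

theorem AdmitsInscribedRegularOctahedron.placeable {p : E3} {v t : Fin 3 → E3}
    (hv : ∀ i, v i ∈ unitSphere) (hv_indep : LinearIndependent ℝ v)
    (ht : IsRegularSphericalTriangle t (Real.pi / 3))
    (h : AdmitsInscribedRegularOctahedron (trihedralAngle p v)) : Placeable v t := by
  obtain ⟨o, r, u, hr, hu, hsub⟩ := h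
  set B := basisOfIndependent v hv_indep
  set c : Fin 3 → ℝ := fun i => B.coord i (o - p) with hc_def
  set m : Fin 3 → Fin 3 → ℝ := fun i j => r * B.coord i (u j) with hm_def
  have hadd : ∀ j, (∀ i, 0 ≤ c i + m i j) ∧ ∃ i, c i + m i j = 0 := by
    intro j
    have := (mem_frontier_trihedralAngle_iff hv_indep).1 (hsub ⟨j, Or.inl rfl⟩)
    simpa only [add_sub_right_comm, map_add, map_smul, smul_eq_mul] using this
  have hsubt : ∀ j, (∀ i, 0 ≤ c i - m i j) ∧ ∃ i, c i - m i j = 0 := by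
    intro j
    have hcm : ∀ i, B.coord i (o - r • u j - p) = c i - m i j := by
      intro i
      rw [sub_right_comm, map_sub _ (o - p), map_smul]
      rfl
    have := (mem_frontier_trihedralAngle_iff hv_indep).1 (hsub ⟨j, Or.inr rfl⟩)
    simpa only [← hcm] using this
  -- If the centre lay on a face plane, opposite vertices would both lie in it, and the coordinate
  -- would vanish on all axes.
  have hc : ∀ i, 0 < c i := by
    intro i
    have h0 : 0 ≤ c i := by linarith [(hadd 0).1 i, (hsubt 0).1 i]
    refine lt_of_le_of_ne h0 fun hci => ?_
    have hz : ∀ j, B.coord i (u j) = 0 := by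
      intro j
      have : r * B.coord i (u j) = 0 := by
        have e1 := (hadd j).1 i
        have e2 := (hsubt j).1 i
        rw [← hci] at e1 e2
        simp only [hm_def] at e1 e2
        linarith
      exact (mul_eq_zero.1 this).resolve_left hr.ne'
    have e := coord_basisOfIndependent hv_indep i i
    rw [hu.eq_combination (v i)] at e
    simp only [map_add, map_smul] at e
    change _ • B.coord i (u 0) + _ • B.coord i (u 1) + _ • B.coord i (u 2) = _ at e
    simp [-Module.Basis.coord_apply, hz] at e
  -- The factor r / c i turns 0 ≤ c i ± m i j into a bound by 1, with equality exactly when the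
  -- vertex lies on face plane i.
  set n : Fin 3 → E3 := fun i => (r / c i) •
    (InnerProductSpace.toDual ℝ E3).symm (B.coord i).toContinuousLinearMap
  have hn : ∀ i x, inner ℝ (n i) x = r / c i * B.coord i x := by
    intro i x
    simp only [n, inner_smul_left, InnerProductSpace.toDual_symm_apply]
    simp
  have hnu : ∀ i j, inner ℝ (n i) (u j) = m i j / c i := by
    intro i j
    rw [hn, hm_def]
    ring
  have hframe : IsSupportingFrame v n u := by
    refine ⟨hu, fun i => ?_, fun i k hik => ?_, fun i j => ?_⟩
    · rw [hn, coord_basisOfIndependent hv_indep, if_pos rfl, mul_one]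
      exact div_pos hr (hc i)
    · rw [hn, coord_basisOfIndependent hv_indep, if_neg hik.symm, mul_zero]
    · rw [hnu, abs_div, abs_of_pos (hc i), div_le_one (hc i), abs_le]
      constructor <;> linarith [(hadd j).1 i, (hsubt j).1 i]
  refine hframe.placeable ht hv (fun j => ?_) fun j => ?_
  · obtain ⟨i, hi⟩ := (hsubt j).2
    refine ⟨i, ?_⟩
    rw [hnu, div_eq_one_iff_eq (hc i).ne']
    linarith
  · obtain ⟨i, hi⟩ := (hadd j).2
    refine ⟨i, ?_⟩
    rw [hnu, div_eq_iff (hc i).ne']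
    linarith

theorem admitsInscribedRegularOctahedron_of_regular {p : E3} {v t : Fin 3 → E3}
    (hv : LinearIndependent ℝ v) (ht : IsRegularSphericalTriangle t (Real.pi / 3))
    {a b α β γ : ℝ} (ha : 0 ≤ a) (hb : 0 ≤ b) (hα : 0 ≤ α) (hβ : 0 ≤ β) (hγ : 0 ≤ γ)
    (h0 : v 0 = t 0) (h1 : v 1 = a • t 0 + b • t 1) (h2 : v 2 = α • t 0 + β • v 1 + γ • t 2) :
    AdmitsInscribedRegularOctahedron (trihedralAngle p v) := by
  have hb' : 0 < b := by
    refine lt_of_le_of_ne hb fun hb0 => ?_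
    have e := coord_basisOfIndependent hv 1 1
    rw [h1, ← hb0, ← h0, zero_smul, add_zero, map_smul, coord_basisOfIndependent] at e
    simp at e
  have hγ' : 0 < γ := by
    refine lt_of_le_of_ne hγ fun hγ0 => ?_
    have e := coord_basisOfIndependent hv 2 2
    rw [h2, ← hγ0, ← h0, zero_smul, add_zero, map_add, map_smul, map_smul,
      coord_basisOfIndependent, coord_basisOfIndependent] at e
    simp at e
  have t1 : t 1 = b⁻¹ • (v 1 - a • v 0) := by
    rw [h1, h0, add_sub_cancel_left, smul_smul, inv_mul_cancel₀ hb'.ne', one_smul]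
  have t2 : t 2 = γ⁻¹ • (v 2 - α • v 0 - β • v 1) := by
    have : v 2 - α • v 0 - β • v 1 = γ • t 2 := by rw [h2, h0]; abel
    rw [this, smul_smul, inv_mul_cancel₀ hγ'.ne', one_smul]
  have q2 : √2 * (√2)⁻¹ = 1 := mul_inv_cancel₀ (by positivity)
  have s0 : √2 • cubeAxes t 0 = v 0 - t 1 + t 2 := by
    simp only [cubeAxes, Matrix.cons_val_zero, smul_smul, q2, one_smul, h0]
  have s1 : √2 • cubeAxes t 1 = t 2 - v 0 - t 1 := by
    simp only [cubeAxes, Matrix.cons_val_one, Matrix.cons_val_zero, smul_smul, q2, one_smul, h0]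
  have s2 : √2 • cubeAxes t 2 = v 0 - t 1 - t 2 := by
    simp only [cubeAxes, Matrix.cons_val, smul_smul, q2, one_smul, h0]
  -- When v = t the centre is p + t 0 + t 1 + t 2, and the vertices are p + 2 t i and p + 2(t i + t
  -- j). In general each coordinate of the centre is the largest absolute value of that coordinate
  -- on the vectors √2 • `cubeAxes t j`.
  refine ⟨p + ((1 + a / b + α / γ) • v 0 + (1 / b + β / γ) • v 1 + (1 / γ) • v 2), √2,
    cubeAxes t, by positivity, orthonormal_cubeAxes ht, ?_⟩
  have key : ∀ (x : E3) (c₀ c₁ c₂ : ℝ), 0 ≤ c₀ → 0 ≤ c₁ → 0 ≤ c₂ → (c₀ = 0 ∨ c₁ = 0 ∨ c₂ = 0) →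
      x = p + (c₀ • v 0 + c₁ • v 1 + c₂ • v 2) → x ∈ frontier (trihedralAngle p v) := by
    rintro x c₀ c₁ c₂ g0 g1 g2 hc rfl
    have hnn : ∀ i, 0 ≤ ![c₀, c₁, c₂] i := by
      intro i
      fin_cases i <;> simpa
    have := mem_frontier_trihedralAngle (p := p) hv ![c₀, c₁, c₂] hnn
    simp only [Fin.sum_univ_three, Matrix.cons_val_zero, Matrix.cons_val_one,
      Matrix.cons_val] at this
    rcases hc with hc | hc | hc
    · exact this 0 hc
    · exact this 1 hc
    · exact this 2 hc
  rintro x ⟨i, rfl | rfl⟩ <;> fin_cases i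
  · refine key _ (2 + 2 * a / b) 0 (2 / γ) (by positivity) le_rfl (by positivity) (by simp) ?_
    change _ + √2 • cubeAxes t 0 = _
    rw [s0, t1, t2]
    match_scalars <;> ring
  · refine key _ (2 * a / b) 0 (2 / γ) (by positivity) le_rfl (by positivity) (by simp) ?_
    change _ + √2 • cubeAxes t 1 = _
    rw [s1, t1, t2]
    match_scalars <;> ring
  · refine key _ (2 + 2 * a / b + 2 * α / γ) (2 * β / γ) 0 (by positivity) (by positivity) le_rfl
      (by simp) ?_
    change _ + √2 • cubeAxes t 2 = _
    rw [s2, t1, t2]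
    match_scalars <;> ring
  · refine key _ (2 * α / γ) (2 / b + 2 * β / γ) 0 (by positivity) (by positivity) le_rfl
      (by simp) ?_
    change _ - √2 • cubeAxes t 0 = _
    rw [s0, t1, t2]
    match_scalars <;> ring
  · refine key _ (2 + 2 * α / γ) (2 / b + 2 * β / γ) 0 (by positivity) (by positivity) le_rfl
      (by simp) ?_
    change _ - √2 • cubeAxes t 1 = _
    rw [s1, t1, t2]
    match_scalars <;> ring
  · refine key _ 0 (2 / b) (2 / γ) le_rfl (by positivity) (by positivity) (by simp) ?_
    change _ - √2 • cubeAxes t 2 = _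
    rw [s2, t1, t2]
    match_scalars <;> ring

theorem mainTheorem3 (p : E3) (v : Fin 3 → E3) (hv : ∀ i, v i ∈ unitSphere)
    (hv_indep : LinearIndependent ℝ v)
    (t : Fin 3 → E3) (ht : IsRegularSphericalTriangle t (Real.pi / 3)) :
    AdmitsInscribedRegularOctahedron (trihedralAngle p v) ↔
      ∃ (g : E3 ≃ₗᵢ[ℝ] E3) (σ : Equiv.Perm (Fin 3)),
        ProperlyPlaced (fun i => g (v (σ i))) t := by
  refine ⟨fun h => h.placeable hv hv_indep ht, ?_⟩
  rintro ⟨g, σ, -, h0, ⟨-, a, b, ha, hb, h1⟩, -, α, β, γ, hα, hβ, hγ, h2⟩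
  -- Pulling `t` back by the isometry leaves the angle itself in place.
  have ht' : IsRegularSphericalTriangle (fun i => g.symm (t i)) (Real.pi / 3) := by
    rw [isRegularSphericalTriangle_pi_div_three_iff] at ht ⊢
    simpa only [LinearIsometryEquiv.inner_map_map] using ht
  rw [← trihedralAngle_comp_perm p v σ]
  refine admitsInscribedRegularOctahedron_of_regular (hv_indep.comp σ σ.injective) ht' ha hb hα hβ
    hγ ?_ ?_ ?_ <;> apply g.injective
  · simpa using h0
  · simpa using h1
  · simpa using h2
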